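/- Let $\varrho$ be a primitive substitution on an alphabet $\{a_1,\dots,a_N\}$, with substitution matrix $M$ ($M_{ij}$ is the number of letters $a_i$ in $\varrho(a_j)$), and assume that its Perron--Frobenius eigenvalue $\lambda$ is a Pisot--Vijayaraghavan unit, of degree $d$: an algebraic integer $\lambda>1$ which is a unit and all of whose other conjugates lie in the open unit disk. Let $\ell=(\ell_1,\dots,\ell_N)$ be natural interval lengths in $\mathbb{Z}[\lambda]$, that is, $\ell_i\in\mathbb{Z}[\lambda]$, $\ell_i>0$ and $\ell M=\lambda\ell$. Let $T_{ij}\subset\mathbb{Z}[\lambda]$ be the finite set of positions of (the left endpoints of) the tiles of type $i$ in the inflated tile of type $j$: if $\varrho(a_j)=a_{k_1}\cdots a_{k_m}$, then $T_{ij}=\{\ell_{k_1}+\dots+\ell_{k_{q-1}} : 1\leqslant q\leqslant m,\ k_q=i\}$. Let $\kappa_1=\mathrm{id},\kappa_2,\dots,\kappa_r$ be the real embeddings of $\mathbb{Q}(\lambda)$, and let $\sigma_1,\dots,\sigma_s$ be representatives of its pairs of complex conjugate non-real embeddings, so $d=r+2s$. Let $$x^\star=\bigl(\kappa_2(x),\dots,\kappa_r(x),\operatorname{Re}\sigma_1(x),\operatorname{Im}\sigma_1(x),\dots,\operatorname{Re}\sigma_s(x),\operatorname{Im}\sigma_s(x)\bigr)\in\mathbb{R}^{d-1}$$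 for $x\in\mathbb{Q}(\lambda)$, and let $Q$ be the linear map of $\mathbb{R}^{d-1}$ induced by $x\mapsto\lambda x$, which is $$Q=\operatorname{diag}\bigl(\kappa_2(\lambda),\dots,\kappa_r(\lambda)\bigr)\oplus\bigoplus_{i=1}^{s}\begin{pmatrix}\operatorname{Re}\sigma_i(\lambda)&-\operatorname{Im}\sigma_i(\lambda)\\ \operatorname{Im}\sigma_i(\lambda)&\operatorname{Re}\sigma_i(\lambda)\end{pmatrix}.$$ Then there is a unique $N$-tuple $(W_1,\dots,W_N)$ of non-empty compact subsets of $\mathbb{R}^{d-1}$ with $$W_i=\bigcup_{j=1}^{N}\bigcup_{t\in T_{ij}}\bigl(QW_j+t^\star\bigr)\qquad(1\leqslant i\leqslant N).$$ For this tuple, with $1_K$ denoting the characteristic function of $K$, the following holds. 1. For every $1\leqslant i\leqslant N$, one has $1_{W_i}=\sum_{j=1}^{N}\sum_{t\in T_{ij}}1_{QW_j+t^\star}$ Lebesgue-almost everywhere on $\mathbb{R}^{d-1}$. 2. The set $W=\bigcup_{i}W_i$ is compact, and the covering function $\mathfrak{m}_{\mathrm{c}}:=\sum_{i=1}^{N}1_{W_i}$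 satisfies $\mathfrak{m}_{\mathrm{c}}(y)=\mathfrak{m}_{\mathrm{c}}(y)\,1_W(y)$ for all $y\in\mathbb{R}^{d-1}$. It is measurable and integer-valued, and both the set $\{y:\mathfrak{m}_{\mathrm{c}}(y)\neq 0\}$ and its closure, $\operatorname{supp}(\mathfrak{m}_{\mathrm{c}})$, are equal to $W$. Its values on $W$ lie in $\{1,2,\dots,N\}$. -/

import Mathlib

namespace RauzyCover

/-! ### The inflation factor -/

/-- A Pisot-Vijayaraghavan unit: a real algebraic integer `lam > 1` whose inverse is an algebraic
integer as well (so that `lam` is a unit), and all of whose other algebraic conjugates lie in the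
open unit disk. -/
structure PVUnit where
  val : ℝ
  one_lt : 1 < val
  isIntegral : IsIntegral ℤ val
  isIntegral_inv : IsIntegral ℤ val⁻¹
  norm_conj_lt : ∀ z ∈ (minpoly ℚ val).aroots ℂ, z ≠ (val : ℂ) → ‖z‖ < 1

namespace PVUnit

variable (lam : PVUnit)

/-- The field `ℚ(lam)`, as a subfield of `ℝ`. -/
noncomputable abbrev field : IntermediateField ℚ ℝ := IntermediateField.adjoin ℚ {lam.val}

/-- `lam` as an element of `ℚ(lam)`. -/
noncomputable def gen : lam.field := IntermediateField.AdjoinSimple.gen ℚ lam.val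

instance : FiniteDimensional ℚ lam.field :=
  IntermediateField.adjoin.finiteDimensional
    lam.isIntegral.tower_top

instance : NumberField lam.field := ⟨⟩

/-! ### Internal space, the star map and the induced contraction -/

/-- The place of `ℚ(lam)` that belongs to the identity `ℚ(lam) ⊆ ℝ`. -/
noncomputable def idPlace : NumberField.InfinitePlace lam.field :=
  NumberField.InfinitePlace.mk ((algebraMap ℝ ℂ).comp lam.field.val.toRingHom)

/-- The real embeddings `κ₂, …, κ_r` of `ℚ(lam)`, that is, all except the identity. -/
abbrev RealIdx : Type :=
  {w : NumberField.InfinitePlace lam.field // w.IsReal ∧ w ≠ lam.idPlace}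

/-- The pairs `{σ₁, conj σ₁}, …, {σ_s, conj σ_s}` of non-real embeddings of `ℚ(lam)`. -/
abbrev ComplexIdx : Type := {w : NumberField.InfinitePlace lam.field // w.IsComplex}

/-- The `d - 1` coordinates of internal space, where `d` is the degree of `lam`: one for each real
embedding other than the identity, and two (real and imaginary part) for each complex pair. -/
abbrev Idx : Type := lam.RealIdx ⊕ (Fin 2 × lam.ComplexIdx)

noncomputable instance : Fintype lam.RealIdx := Fintype.ofFinite _

noncomputable instance : Fintype lam.ComplexIdx := Fintype.ofFinite _

noncomputable instance : DecidableEq lam.RealIdx := Classical.decEq _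

noncomputable instance : DecidableEq lam.ComplexIdx := Classical.decEq _

/-- Internal space `ℝ^(d-1)`. -/
abbrev Internal : Type := EuclideanSpace ℝ lam.Idx

/-- The real embedding `κ : ℚ(lam) → ℝ` with index `w`. -/
noncomputable def kappa (w : lam.RealIdx) : lam.field →+* ℝ :=
  NumberField.InfinitePlace.embedding_of_isReal w.2.1

/-- A representative `σ : ℚ(lam) → ℂ` of the complex pair with index `w`. -/
noncomputable def sigma (w : lam.ComplexIdx) : lam.field →+* ℂ :=
  NumberField.InfinitePlace.embedding w.1

/-- The star map `x ↦ (κ₂ x, …, κ_r x, Re (σ₁ x), Im (σ₁ x), …, Re (σ_s x), Im (σ_s x))`. -/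
noncomputable def star (x : lam.field) : lam.Internal :=
  WithLp.toLp 2 (Sum.elim (fun w => lam.kappa w x)
    (fun p => ![(lam.sigma p.2 x).re, (lam.sigma p.2 x).im] p.1))

/-- The matrix `diag (κ₂ lam, …, κ_r lam) ⊕ ⨁ᵢ !![Re (σᵢ lam), -Im (σᵢ lam);
Im (σᵢ lam), Re (σᵢ lam)]` of the map induced on internal space by `x ↦ lam * x`. -/
noncomputable def QMatrix : Matrix lam.Idx lam.Idx ℝ :=
  Matrix.fromBlocks (Matrix.diagonal fun w => lam.kappa w lam.gen) 0 0
    (Matrix.blockDiagonal fun w : lam.ComplexIdx =>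
      !![(lam.sigma w lam.gen).re, -(lam.sigma w lam.gen).im;
         (lam.sigma w lam.gen).im, (lam.sigma w lam.gen).re])

/-- The linear map `Q` on internal space. -/
noncomputable def Q : lam.Internal →ₗ[ℝ] lam.Internal := Matrix.toEuclideanLin lam.QMatrix

end PVUnit

/-! ### Substitutions and inflations -/

section Inflation

variable {N : ℕ}

/-- The substitution matrix: `M i j` is the number of letters `i` in the word `rho j`. -/
def substMatrix (rho : Fin N → List (Fin N)) : Matrix (Fin N) (Fin N) ℝ :=
  fun i j => ((rho j).count i : ℝ)

/-- Natural interval lengths with all coordinates in `ℤ[lam]`: the vector of lengths is a strictly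
positive left eigenvector of the substitution matrix for the eigenvalue `lam`. (For a primitive
substitution, the existence of such a vector says that `lam` is the Perron-Frobenius
eigenvalue.) -/
structure IsNaturalLength (lam : PVUnit) (rho : Fin N → List (Fin N))
    (len : Fin N → lam.field) : Prop where
  pos : ∀ i, 0 < (len i : ℝ)
  mem : ∀ i, (len i : ℝ) ∈ Algebra.adjoin ℤ {lam.val}
  eigen : Matrix.vecMul (fun i => (len i : ℝ)) (substMatrix rho) =
    lam.val • fun i => (len i : ℝ)

variable {lam : PVUnit}

/-- The left endpoint of the tile number `k` (counted from `0`) in the supertile of type `j`, whose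
own left endpoint is at `0`: the total length of all tiles before it. -/
noncomputable def tilePos (rho : Fin N → List (Fin N)) (len : Fin N → lam.field) (j : Fin N) (k : ℕ) :
    lam.field :=
  (((rho j).take k).map len).sum

open Classical in
/-- The entry `T i j` of the displacement matrix: the set of positions of the tiles of type `i` in
the supertile of type `j`. -/
noncomputable def displacement (rho : Fin N → List (Fin N)) (len : Fin N → lam.field)
    (i j : Fin N) : Finset lam.field :=
  (Finset.univ.filter fun k : Fin (rho j).length => (rho j).get k = i).image
    fun k => tilePos rho len j k

/-- The affine image `Q K + t^⋆` of a subset `K` of internal space. -/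
def affineImage (t : lam.field) (K : Set lam.Internal) : Set lam.Internal :=
  (fun y => lam.Q y + lam.star t) '' K

/-- `W` is a tuple of non-empty compact subsets of internal space that solves the iterated function
system `W i = ⋃ j, ⋃ t ∈ T i j, Q (W j) + t^⋆`. -/
def IsWindowSystem (rho : Fin N → List (Fin N)) (len : Fin N → lam.field)
    (W : Fin N → TopologicalSpace.NonemptyCompacts lam.Internal) : Prop :=
  ∀ i, (W i : Set lam.Internal) =
    ⋃ j, ⋃ t ∈ displacement rho len i j, affineImage t (W j : Set lam.Internal)

/-- The characteristic function of a set. -/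
noncomputable def chi {X : Type*} (K : Set X) : X → ℝ := K.indicator fun _ => 1

/-- The total window, `⋃ i, W i`. -/
def totalWindow (W : Fin N → TopologicalSpace.NonemptyCompacts lam.Internal) :
    Set lam.Internal :=
  ⋃ i, (W i : Set lam.Internal)

/-- The covering function, `∑ i, 1_{W i}`. -/
noncomputable def covering (W : Fin N → TopologicalSpace.NonemptyCompacts lam.Internal)
    (y : lam.Internal) : ℝ :=
  ∑ i, chi (W i : Set lam.Internal) y

end Inflation

end RauzyCover

open RauzyCover MeasureTheory

open RauzyCover MeasureTheory

namespace RauzyCover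

open TopologicalSpace NumberField

/-! ### Infinite places of ℚ(λ) and the norm of λ. -/

namespace PVUnit

variable (lam : PVUnit)

/-! The conjugates of the unit λ multiply to ±1, and all of them except λ, which are the eigenvalues
of `Q`, lie in the open unit disk. Hence `Q` is a contraction (`exists_contraction`) and |det Q| =
1/λ (`val_mul_abs_det_Q`).

The contraction gives the windows: the set equations define a contraction on tuples of non-empty
compact sets for the Hausdorff distance, so Banach's theorem applies (`existsUnique_ifs`).

The determinant gives part 1. Let v be the vector of volumes of the W_i, and S_i the sum of the
volumes of the pieces of W_i. Then v ≤ S ≤ λ⁻¹ M v entrywise. Pairing with the positive left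
eigenvector ℓ gives the same number at both ends, so v = S (`IsWindowSystem.volume_sum_le`) and the
pieces overlap only in null sets. The volumes need not be positive for this.

For part 2, the covering function counts the windows containing a point, so it is non-zero exactly
on the compact set W. -/

theorem coe_gen : (lam.gen : ℝ) = lam.val :=
  IntermediateField.AdjoinSimple.coe_gen ℚ lam.val

theorem idPlace_gen : lam.idPlace lam.gen = lam.val := by
  have h : lam.idPlace lam.gen = ‖((lam.gen : ℝ) : ℂ)‖ := rfl
  rw [h, coe_gen, Complex.norm_real, Real.norm_eq_abs, abs_of_pos (zero_lt_one.trans lam.one_lt)]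

theorem isReal_idPlace : lam.idPlace.IsReal := by
  refine ⟨_, ?_, rfl⟩
  ext x
  exact Complex.conj_ofReal _

/-- An embedding of `ℚ(lam)` is determined by the image of `lam`. -/
theorem embedding_eq_of_gen {φ : lam.field →+* ℂ} (h : φ lam.gen = lam.val) :
    φ = (algebraMap ℝ ℂ).comp lam.field.val.toRingHom := by
  have := IntermediateField.adjoin_algHom_ext ℚ (s := {lam.val})
    (φ₁ := φ.toRatAlgHom) (φ₂ := ((algebraMap ℝ ℂ).comp lam.field.val.toRingHom).toRatAlgHom) (by
      rintro _ rfl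
      exact h)
  exact congrArg AlgHom.toRingHom this

/-- An embedding sends λ to a root of its minimal polynomial; if that root were λ itself, the
embedding would be the identity. -/
theorem place_gen_lt_one {w : InfinitePlace lam.field} (hw : w ≠ lam.idPlace) :
    w lam.gen < 1 := by
  rw [← InfinitePlace.norm_embedding_eq]
  apply lam.norm_conj_lt
  · rw [Polynomial.mem_aroots]
    refine ⟨minpoly.ne_zero lam.isIntegral.tower_top, ?_⟩
    have h : Polynomial.aeval lam.gen (minpoly ℚ lam.val) = 0 :=
      IntermediateField.aeval_gen_minpoly ℚ lam.val
    have := congrArg w.embedding.toRatAlgHom h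
    rwa [← Polynomial.aeval_algHom_apply, map_zero] at this
  · intro h
    apply hw
    rw [← InfinitePlace.mk_embedding w, lam.embedding_eq_of_gen h]
    rfl

/-- The norms of λ and λ⁻¹ are rational integers with product 1. -/
theorem abs_norm_gen : |Algebra.norm ℚ lam.gen| = 1 := by
  have inj : Function.Injective (algebraMap lam.field ℝ) := (algebraMap lam.field ℝ).injective
  have hg : IsIntegral ℤ lam.gen := by
    rw [← isIntegral_algebraMap_iff inj]
    change IsIntegral ℤ (lam.gen : ℝ)
    rw [coe_gen]
    exact lam.isIntegral
  have hg' : IsIntegral ℤ lam.gen⁻¹ := by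
    rw [← isIntegral_algebraMap_iff inj, map_inv₀]
    change IsIntegral ℤ (lam.gen : ℝ)⁻¹
    rw [coe_gen]
    exact lam.isIntegral_inv
  have h0 : lam.gen ≠ 0 := fun h => by
    have h1 := lam.one_lt
    rw [← lam.coe_gen, h, ZeroMemClass.coe_zero] at h1
    exact zero_le_one.not_gt h1
  obtain ⟨a, ha⟩ := IsIntegrallyClosed.isIntegral_iff.1 (Algebra.isIntegral_norm ℚ hg)
  obtain ⟨b, hb⟩ := IsIntegrallyClosed.isIntegral_iff.1 (Algebra.isIntegral_norm ℚ hg')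
  have hab : a * b = 1 := by
    have : Algebra.norm ℚ lam.gen * Algebra.norm ℚ lam.gen⁻¹ = 1 := by
      rw [← map_mul, mul_inv_cancel₀ h0, map_one]
    rw [← ha, ← hb] at this
    simp only [eq_intCast] at this
    exact_mod_cast this
  rw [← ha]
  have := Int.isUnit_iff_abs_eq.1 (IsUnit.of_mul_eq_one b hab)
  simp only [eq_intCast]
  exact_mod_cast this

theorem prod_places (f : InfinitePlace lam.field → ℝ) :
    ∏ w, f w = f lam.idPlace * ((∏ w : lam.RealIdx, f w.1) * ∏ w : lam.ComplexIdx, f w.1) := by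
  classical
  have hr : ∏ w : lam.RealIdx, f w.1 =
      ∏ w ∈ Finset.univ.filter fun w : InfinitePlace lam.field => w.IsReal ∧ w ≠ lam.idPlace, f w :=
    (Finset.prod_subtype _ (by simp) f).symm
  have hc : ∏ w : lam.ComplexIdx, f w.1 =
      ∏ w ∈ Finset.univ.filter fun w : InfinitePlace lam.field => w.IsComplex, f w :=
    (Finset.prod_subtype _ (by simp) f).symm
  rw [hr, hc, ← Finset.prod_union, ← Finset.prod_insert]
  · congr 1
    ext w
    simp only [Finset.mem_univ, Finset.mem_insert, Finset.mem_union, Finset.mem_filter, true_and,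
      true_iff]
    have := w.isReal_or_isComplex
    tauto
  · simp [InfinitePlace.not_isComplex_iff_isReal.2 lam.isReal_idPlace]
  · rw [Finset.disjoint_filter]
    rintro w - ⟨h, -⟩ h'
    exact InfinitePlace.not_isComplex_iff_isReal.2 h h'

/-! ### Determinant and operator norm of `Q`. -/

theorem abs_kappa (w : lam.RealIdx) (x : lam.field) : |lam.kappa w x| = w.1 x := by
  rw [← InfinitePlace.norm_embedding_of_isReal w.2.1, Real.norm_eq_abs]
  rfl

theorem sigma_sq (w : lam.ComplexIdx) (x : lam.field) :
    (lam.sigma w x).re ^ 2 + (lam.sigma w x).im ^ 2 = w.1 x ^ 2 := by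
  rw [← InfinitePlace.norm_embedding_eq, Complex.sq_norm, Complex.normSq_apply]
  simp only [sigma]
  ring

theorem det_Q : LinearMap.det lam.Q = (∏ w, lam.kappa w lam.gen) * ∏ w : lam.ComplexIdx,
    w.1 lam.gen ^ 2 := by
  rw [Q, Matrix.toEuclideanLin, Matrix.toLpLin_eq_toLin, LinearMap.det_toLin, QMatrix,
    Matrix.det_fromBlocks_zero₂₁, Matrix.det_diagonal, Matrix.det_blockDiagonal]
  congr 1
  refine Finset.prod_congr rfl fun w _ => ?_
  rw [← sigma_sq, Matrix.det_fin_two_of]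
  ring

/-- Product formula over the infinite places: the identity place contributes λ, the others
contribute |det Q|, and together they give |N(λ)| = 1. -/
theorem val_mul_abs_det_Q : lam.val * |LinearMap.det lam.Q| = 1 := by
  have h := InfinitePlace.prod_eq_abs_norm lam.gen
  rw [lam.abs_norm_gen, lam.prod_places, lam.isReal_idPlace.mult_eq_one, idPlace_gen] at h
  rw [det_Q, abs_mul, Finset.abs_prod, Finset.abs_prod]
  simp only [abs_kappa, abs_pow, abs_of_nonneg (apply_nonneg _ lam.gen)]
  simpa only [InfinitePlace.mult_isReal, InfinitePlace.IsReal.mult_eq_one,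
    InfinitePlace.IsComplex.mult_eq_two, Subtype.prop, pow_one, Rat.cast_one,
    fun w : lam.RealIdx => w.2.1.mult_eq_one] using h

theorem Q_apply_inl (y : lam.Internal) (w : lam.RealIdx) :
    lam.Q y (Sum.inl w) = lam.kappa w lam.gen * y (Sum.inl w) := by
  simp [Q, QMatrix, Matrix.toLpLin_apply, Matrix.mulVec, dotProduct, Matrix.diagonal_apply]

theorem Q_apply_zero (y : lam.Internal) (w : lam.ComplexIdx) :
    lam.Q y (Sum.inr (0, w)) = (lam.sigma w lam.gen).re * y (Sum.inr (0, w)) -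
      (lam.sigma w lam.gen).im * y (Sum.inr (1, w)) := by
  simp [Q, QMatrix, Matrix.toLpLin_apply, Matrix.mulVec, dotProduct,
    Matrix.blockDiagonal_apply, Fintype.sum_prod_type, Fin.sum_univ_two, sub_eq_add_neg]

theorem Q_apply_one (y : lam.Internal) (w : lam.ComplexIdx) :
    lam.Q y (Sum.inr (1, w)) = (lam.sigma w lam.gen).im * y (Sum.inr (0, w)) +
      (lam.sigma w lam.gen).re * y (Sum.inr (1, w)) := by
  simp [Q, QMatrix, Matrix.toLpLin_apply, Matrix.mulVec, dotProduct,
    Matrix.blockDiagonal_apply, Fintype.sum_prod_type, Fin.sum_univ_two]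

/-- Each complex block is a rotation scaled by |σ(λ)|, so squared norms can be compared block by
block. -/
theorem norm_Q_le {c : ℝ} (hc0 : 0 ≤ c) (hc : ∀ w ≠ lam.idPlace, w lam.gen ≤ c)
    (y : lam.Internal) : ‖lam.Q y‖ ≤ c * ‖y‖ := by
  apply le_of_sq_le_sq _ (by positivity)
  rw [mul_pow, EuclideanSpace.real_norm_sq_eq, EuclideanSpace.real_norm_sq_eq]
  simp only [Fintype.sum_sum_type, Fintype.sum_prod_type, Fin.sum_univ_two, mul_add,
    ← Finset.sum_add_distrib, Finset.mul_sum]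
  refine add_le_add (Finset.sum_le_sum fun w _ => ?_) (Finset.sum_le_sum fun w _ => ?_)
  · rw [Q_apply_inl, mul_pow, ← sq_abs (lam.kappa w lam.gen), abs_kappa]
    gcongr
    exact hc _ w.2.2
  · have hw : w.1 ≠ lam.idPlace := fun h =>
      InfinitePlace.not_isComplex_iff_isReal.2 lam.isReal_idPlace (h ▸ w.2)
    rw [Q_apply_zero, Q_apply_one, ← mul_add]
    have : w.1 lam.gen ^ 2 ≤ c ^ 2 := by
      gcongr
      exact hc _ hw
    rw [← sigma_sq] at this
    refine le_of_eq_of_le ?_ (mul_le_mul_of_nonneg_right this (by positivity))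
    ring

/-- The map `Q` is a contraction of internal space for the Euclidean norm. -/
theorem exists_contraction : ∃ c : NNReal, c < 1 ∧ LipschitzWith c lam.Q := by
  classical
  let g : InfinitePlace lam.field → NNReal := fun w => ⟨w lam.gen, apply_nonneg _ _⟩
  let c := (Finset.univ.filter fun w => w ≠ lam.idPlace).sup g
  refine ⟨c, ?_, ?_⟩
  · rw [Finset.sup_lt_iff (by simp)]
    intro w hw
    exact lam.place_gen_lt_one (Finset.mem_filter.1 hw).2
  · refine LipschitzWith.of_dist_le_mul fun x y => ?_
    rw [dist_eq_norm, dist_eq_norm, ← map_sub]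
    refine lam.norm_Q_le c.2 (fun w hw => ?_) _
    have : g w ≤ c := Finset.le_sup (f := g) (by simp [hw])
    exact this

end PVUnit

/-! ### Finite unions of contractions on tuples of compact sets -/

section IteratedFunctionSystem

variable {X ι α : Type*} [MetricSpace X]

theorem hausdorffEDist_image_le {f : X → X} {c : NNReal} (hf : LipschitzWith c f) {s t : Set X}
    (hs : s.Nonempty) (ht : t.Nonempty) :
    Metric.hausdorffEDist (f '' s) (f '' t) ≤ c * Metric.hausdorffEDist s t := by
  have key : ∀ s t : Set X, t.Nonempty → ∀ x ∈ f '' s,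
      Metric.infEDist x (f '' t) ≤ c * Metric.hausdorffEDist s t := by
    rintro s t ht _ ⟨x, hx, rfl⟩
    refine le_trans ?_ (mul_le_mul_right (Metric.infEDist_le_hausdorffEDist_of_mem hx) _)
    -- Non-emptiness matters when `c = 0`: an empty infimum is `⊤`, but `0 * ⊤ = 0`.
    have := ht.to_subtype
    rw [Metric.infEDist, Metric.infEDist, iInf_image, iInf_subtype', iInf_subtype',
      ENNReal.mul_iInf (by simp)]
    exact iInf_mono fun y => hf x y
  refine Metric.hausdorffEDist_le_of_infEDist (key s t ht) ?_
  rw [Metric.hausdorffEDist_comm]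
  exact key t s hs

/-- Banach's fixed point theorem on the complete space of tuples of non-empty compact sets.
Non-empty index sets `I i` keep the unions non-empty. -/
theorem existsUnique_ifs [CompleteSpace X] [Nonempty X] [Fintype ι] {c : NNReal} (hc : c < 1)
    (I : ι → Finset α) (hI : ∀ i, (I i).Nonempty) (σ : α → ι) (f : α → X → X)
    (hf : ∀ a, LipschitzWith c (f a)) :
    ∃! W : ι → NonemptyCompacts X, ∀ i, (W i : Set X) = ⋃ a ∈ I i, f a '' W (σ a) := by
  let F : (ι → NonemptyCompacts X) → ι → NonemptyCompacts X := fun W i =>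
    (I i).sup' (hI i) fun a => (W (σ a)).map (f a) (hf a).continuous
  have hF : ∀ W i, (F W i : Set X) = ⋃ a ∈ I i, f a '' W (σ a) := fun W i => by
    have h : ∀ (s : Finset α) (hs : s.Nonempty) (g : α → NonemptyCompacts X),
        ((s.sup' hs g : NonemptyCompacts X) : Set X) = ⋃ a ∈ s, (g a : Set X) := by
      classical
      intro s hs g
      induction hs using Finset.Nonempty.cons_induction with
      | singleton a => simp
      | cons a s h hs ih => rw [Finset.sup'_cons hs]; simp [ih]
    simp [F, h]
  have hcontr : ContractingWith c F := by
    refine ⟨hc, fun V W => ?_⟩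
    rw [edist_pi_le_iff]
    intro i
    change Metric.hausdorffEDist (F V i : Set X) (F W i) ≤ _
    rw [hF, hF]
    refine Metric.hausdorffEDist_iUnion_le.trans (iSup_le fun a => ?_)
    refine Metric.hausdorffEDist_iUnion_le.trans (iSup_le fun _ => ?_)
    refine (hausdorffEDist_image_le (hf a) (V _).nonempty (W _).nonempty).trans ?_
    gcongr
    exact edist_le_pi_edist V W (σ a)
  have hfix : ∀ W : ι → NonemptyCompacts X,
      (∀ i, (W i : Set X) = ⋃ a ∈ I i, f a '' W (σ a)) ↔ Function.IsFixedPt F W := fun W => by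
    rw [Function.IsFixedPt, funext_iff]
    refine forall_congr' fun i => ?_
    rw [← hF, SetLike.coe_set_eq, eq_comm]
  refine ⟨ContractingWith.fixedPoint F hcontr, (hfix _).2 hcontr.fixedPoint_isFixedPt, fun W hW =>
    hcontr.fixedPoint_unique ((hfix W).1 hW)⟩

end IteratedFunctionSystem

/-! ### Measure-disjoint unions -/

/-- The sum of indicators dominates the indicator of the union, and by `h` the non-negative
difference has integral at most 0. -/
theorem chi_biUnion_ae_eq {X α : Type*} [MeasurableSpace X] {μ : Measure X} (s : Finset α)
    (A : α → Set X) (hA : ∀ a ∈ s, MeasurableSet (A a)) (hfin : ∀ a ∈ s, μ (A a) ≠ ⊤)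
    (h : ∑ a ∈ s, μ.real (A a) ≤ μ.real (⋃ a ∈ s, A a)) :
    chi (⋃ a ∈ s, A a) =ᵐ[μ] fun y => ∑ a ∈ s, chi (A a) y := by
  have hint : ∀ a ∈ s, Integrable (chi (A a)) μ := fun a ha =>
    (integrable_indicator_iff (hA a ha)).2 (integrableOn_const (hfin a ha))
  have hU : MeasurableSet (⋃ a ∈ s, A a) := Finset.measurableSet_biUnion s hA
  have hUfin : μ (⋃ a ∈ s, A a) ≠ ⊤ :=
    (measure_biUnion_lt_top s.finite_toSet fun a ha => (hfin a ha).lt_top).ne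
  have hUint : Integrable (chi (⋃ a ∈ s, A a)) μ :=
    (integrable_indicator_iff hU).2 (integrableOn_const hUfin)
  have hsum : Integrable (fun y => ∑ a ∈ s, chi (A a) y) μ := integrable_finsetSum s hint
  have hchi : ∀ (B : Set X) y, 0 ≤ chi B y := fun B y =>
    Set.indicator_nonneg (fun _ _ => zero_le_one) y
  have hle : ∀ y, chi (⋃ a ∈ s, A a) y ≤ ∑ a ∈ s, chi (A a) y := fun y => by
    by_cases hy : y ∈ ⋃ a ∈ s, A a
    · obtain ⟨a, ha, hya⟩ := Set.mem_iUnion₂.1 hy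
      have : chi (A a) y = 1 := Set.indicator_of_mem hya _
      rw [chi, Set.indicator_of_mem hy, ← this]
      exact Finset.single_le_sum (f := fun a => chi (A a) y) (fun a _ => hchi _ y) ha
    · rw [chi, Set.indicator_of_notMem hy]
      exact Finset.sum_nonneg fun a _ => hchi _ y
  have hval : ∀ B : Set X, MeasurableSet B → ∫ y, chi B y ∂μ = μ.real B := fun B hB =>
    integral_indicator_one hB
  have hnonneg : 0 ≤ fun y => ∑ a ∈ s, chi (A a) y - chi (⋃ a ∈ s, A a) y := fun y =>
    sub_nonneg.2 (hle y)
  have hzero : ∫ y, (∑ a ∈ s, chi (A a) y - chi (⋃ a ∈ s, A a) y) ∂μ = 0 := by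
    refine le_antisymm ?_ (integral_nonneg hnonneg)
    rw [integral_sub hsum hUint, integral_finsetSum s hint, hval _ hU,
      Finset.sum_congr rfl fun a ha => hval _ (hA a ha)]
    linarith
  filter_upwards [(integral_eq_zero_iff_of_nonneg hnonneg (hsum.sub hUint)).1 hzero] with y hy
  exact (sub_eq_zero.1 hy).symm

/-! ### Windows -/

section Windows

variable {N : ℕ} {lam : PVUnit} {rho : Fin N → List (Fin N)} {len : Fin N → lam.field}

theorem card_filter_get_eq_count {α : Type*} [DecidableEq α] (l : List α) (a : α) :
    (Finset.univ.filter fun k : Fin l.length => l.get k = a).card = l.count a :=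
  Fin.card_filter_univ_eq_vector_get_eq_count a (⟨l, rfl⟩ : List.Vector α l.length)

theorem displacement_eq_image (i j : Fin N) [DecidableEq lam.field] :
    displacement rho len i j =
      (Finset.univ.filter fun k : Fin (rho j).length => (rho j).get k = i).image
        fun k : Fin (rho j).length => tilePos rho len j k := by
  ext t
  simp [displacement]

theorem card_displacement_le (i j : Fin N) :
    ((displacement rho len i j).card : ℝ) ≤ substMatrix rho i j := by
  classical
  -- Distinct tiles do have distinct positions when lengths are positive, but the upper bound is
  -- enough.
  rw [substMatrix, Nat.cast_le, displacement_eq_image, ← card_filter_get_eq_count]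
  exact Finset.card_image_le

/-- A primitive matrix has no zero row: a positive diagonal entry of a power forces a non-zero entry
in the corresponding row of `M`. -/
theorem exists_mem_displacement (hprim : (substMatrix rho).IsPrimitive) (i : Fin N) :
    ∃ j, (displacement rho len i j).Nonempty := by
  classical
  obtain ⟨k, hk, hpos⟩ := hprim.exists_pos_pow
  have h := hpos i i
  obtain ⟨k, rfl⟩ := Nat.exists_eq_succ_of_ne_zero hk.ne'
  rw [Nat.succ_eq_add_one, pow_succ', Matrix.mul_apply] at h
  obtain ⟨j, -, hj⟩ := Finset.exists_ne_zero_of_sum_ne_zero h.ne'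
  refine ⟨j, ?_⟩
  rw [displacement_eq_image]
  have hM : (rho j).count i ≠ 0 := fun h0 => left_ne_zero_of_mul hj (by simp [substMatrix, h0])
  obtain ⟨n, hn⟩ := List.mem_iff_get.1 (List.count_pos_iff.1 (Nat.pos_of_ne_zero hM))
  exact ⟨_, Finset.mem_image_of_mem _ (Finset.mem_filter.2 ⟨Finset.mem_univ n, hn⟩)⟩

theorem continuous_affine (t : lam.field) :
    Continuous fun y : lam.Internal => lam.Q y + lam.star t :=
  lam.Q.continuous_of_finiteDimensional.add continuous_const

theorem volume_real_affineImage (t : lam.field) (K : Set lam.Internal) :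
    (volume : Measure lam.Internal).real (affineImage t K) =
      |LinearMap.det lam.Q| * (volume : Measure lam.Internal).real K := by
  have : affineImage t K = (fun y => y + lam.star t) '' (lam.Q '' K) := by
    rw [Set.image_image]; rfl
  rw [Measure.real, Measure.real, this, Set.image_add_right, measure_preimage_add_right,
    Measure.addHaar_image_linearMap, ENNReal.toReal_mul, ENNReal.toReal_ofReal (abs_nonneg _)]

variable {W : Fin N → NonemptyCompacts lam.Internal}

/-- Merges the double union into one over pairs (j, t), the form used by the general lemmas on
unions. -/
theorem isWindowSystem_iff : IsWindowSystem rho len W ↔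
    ∀ i, (W i : Set lam.Internal) =
      ⋃ a ∈ Finset.univ.sigma fun j => displacement rho len i j,
        affineImage a.2 (W a.1 : Set lam.Internal) := by
  refine forall_congr' fun i => ?_
  have : (⋃ a ∈ Finset.univ.sigma fun j => displacement rho len i j,
      affineImage a.2 (W a.1 : Set lam.Internal)) =
      ⋃ j, ⋃ t ∈ displacement rho len i j, affineImage t (W j : Set lam.Internal) := by
    ext y
    simp
  rw [this]

theorem existsUnique_isWindowSystem (hprim : (substMatrix rho).IsPrimitive) :
    ∃! W : Fin N → NonemptyCompacts lam.Internal, IsWindowSystem rho len W := by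
  obtain ⟨c, hc, hQ⟩ := lam.exists_contraction
  simp_rw [isWindowSystem_iff]
  refine existsUnique_ifs hc (fun i => Finset.univ.sigma fun j => displacement rho len i j)
    (fun i => ?_) Sigma.fst (fun a y => lam.Q y + lam.star a.2) fun a x y => ?_
  · obtain ⟨j, t, ht⟩ := exists_mem_displacement (len := len) hprim i
    exact ⟨⟨j, t⟩, by simpa using ht⟩
  · rw [edist_add_right]
    exact hQ x y

theorem IsWindowSystem.volume_sum_le (hlen : IsNaturalLength lam rho len)
    (hW : IsWindowSystem rho len W) (i : Fin N) :
    ∑ a ∈ Finset.univ.sigma fun j => displacement rho len i j,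
        (volume : Measure lam.Internal).real (affineImage a.2 (W a.1 : Set lam.Internal)) ≤
      (volume : Measure lam.Internal).real (W i) := by
  let v : Fin N → ℝ := fun i => (volume : Measure lam.Internal).real (W i)
  let D := |LinearMap.det lam.Q|
  let S : Fin N → ℝ := fun i => ∑ a ∈ Finset.univ.sigma fun j => displacement rho len i j,
    (volume : Measure lam.Internal).real (affineImage a.2 (W a.1 : Set lam.Internal))
  have hv : ∀ i, v i ≤ S i := fun i => by
    change (volume : Measure lam.Internal).real _ ≤ _
    rw [isWindowSystem_iff.1 hW i]
    exact measureReal_biUnion_finset_le _ _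
  have hS : ∀ i, S i ≤ D * ∑ j, substMatrix rho i j * v j := fun i => by
    simp only [S, Finset.sum_sigma, volume_real_affineImage, Finset.sum_const, nsmul_eq_mul,
      Finset.mul_sum]
    refine Finset.sum_le_sum fun j _ => ?_
    rw [mul_left_comm]
    have h0 : 0 ≤ v j := measureReal_nonneg
    have := card_displacement_le (rho := rho) (len := len) i j
    have hD : 0 ≤ D := abs_nonneg _
    change D * (_ * v j) ≤ D * (_ * v j)
    gcongr
  -- Here ℓM = λℓ cancels against |det Q| = 1/λ.
  have htotal : ∑ i, (len i : ℝ) * (D * ∑ j, substMatrix rho i j * v j) =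
      ∑ j, (len j : ℝ) * v j := by
    have heig : ∀ j, ∑ i, (len i : ℝ) * substMatrix rho i j = lam.val * len j := fun j =>
      congrFun hlen.eigen j
    calc _ = ∑ j, D * (∑ i, (len i : ℝ) * substMatrix rho i j) * v j := by
          simp only [Finset.mul_sum, Finset.sum_mul]
          rw [Finset.sum_comm]
          exact Finset.sum_congr rfl fun j _ => Finset.sum_congr rfl fun i _ => by ring
      _ = _ := by
          refine Finset.sum_congr rfl fun j _ => ?_
          rw [heig]
          linear_combination (len j : ℝ) * v j * lam.val_mul_abs_det_Q
  have hle : ∀ i ∈ Finset.univ, (len i : ℝ) * v i ≤ (len i : ℝ) * S i := fun i _ =>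
    mul_le_mul_of_nonneg_left (hv i) (hlen.pos i).le
  have hsum : ∑ i, (len i : ℝ) * S i ≤ ∑ i, (len i : ℝ) * v i :=
    htotal ▸ Finset.sum_le_sum fun i _ => mul_le_mul_of_nonneg_left (hS i) (hlen.pos i).le
  -- The weighted sums of v and S agree, so the termwise inequalities are equalities.
  have := (Finset.sum_eq_sum_iff_of_le hle).1 (le_antisymm (Finset.sum_le_sum hle) hsum) i
    (Finset.mem_univ i)
  exact (mul_left_cancel₀ (hlen.pos i).ne' this).ge

theorem IsWindowSystem.chi_ae_eq (hlen : IsNaturalLength lam rho len)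
    (hW : IsWindowSystem rho len W) (i : Fin N) :
    chi (W i : Set lam.Internal) =ᵐ[volume] fun y =>
      ∑ j, ∑ t ∈ displacement rho len i j, chi (affineImage t (W j : Set lam.Internal)) y := by
  have hcomp : ∀ a : (_ : Fin N) × lam.field,
      IsCompact (affineImage a.2 (W a.1 : Set lam.Internal)) := fun a =>
    (W a.1).isCompact.image (continuous_affine a.2)
  have hvol := hW.volume_sum_le hlen i
  have hU := isWindowSystem_iff.1 hW i
  rw [hU] at hvol ⊢
  have := chi_biUnion_ae_eq (μ := (volume : Measure lam.Internal)) _ _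
    (fun a _ => (hcomp a).measurableSet) (fun a _ => (hcomp a).measure_ne_top) hvol
  simpa only [Finset.sum_sigma] using this

/-! ### The covering function as a counting function. -/

theorem covering_eq_card (W : Fin N → NonemptyCompacts lam.Internal) (y : lam.Internal) :
    covering W y = Nat.card {i // y ∈ W i} := by
  classical
  rw [Nat.card_eq_fintype_card, Fintype.card_subtype, Finset.card_filter, covering]
  push_cast
  exact Finset.sum_congr rfl fun i _ => by simp [chi, Set.indicator_apply]

theorem support_covering (W : Fin N → NonemptyCompacts lam.Internal) :
    Function.support (covering W) = totalWindow W := by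
  ext y
  simp [covering_eq_card, totalWindow, Nat.card_eq_zero, Finite.not_infinite]

theorem isCompact_totalWindow (W : Fin N → NonemptyCompacts lam.Internal) :
    IsCompact (totalWindow W) :=
  isCompact_iUnion fun i => (W i).isCompact

theorem measurable_covering (W : Fin N → NonemptyCompacts lam.Internal) :
    Measurable (covering W) :=
  Finset.measurable_fun_sum _ fun i _ =>
    measurable_const.indicator (W i).isCompact.measurableSet

end Windows

end RauzyCover

theorem mainTheorem9 {N : ℕ} (lam : PVUnit)
    (rho : Fin N → List (Fin N)) (hprim : (substMatrix rho).IsPrimitive)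
    (len : Fin N → lam.field) (hlen : IsNaturalLength lam rho len) :
    (∃! W : Fin N → TopologicalSpace.NonemptyCompacts lam.Internal, IsWindowSystem rho len W) ∧
    ∀ W : Fin N → TopologicalSpace.NonemptyCompacts lam.Internal, IsWindowSystem rho len W →
      (∀ i, chi (W i : Set lam.Internal) =ᵐ[volume] fun y =>
        ∑ j, ∑ t ∈ displacement rho len i j,
          chi (affineImage t (W j : Set lam.Internal)) y) ∧
      IsCompact (totalWindow W) ∧
      (∀ y, covering W y = covering W y * chi (totalWindow W) y) ∧
      Measurable (covering W) ∧
      (∀ y, ∃ m : ℤ, covering W y = m) ∧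
      Function.support (covering W) = totalWindow W ∧
      tsupport (covering W) = totalWindow W ∧
      (∀ y ∈ totalWindow W, ∃ m : ℕ, 1 ≤ m ∧ m ≤ N ∧ covering W y = m) := by
  refine ⟨existsUnique_isWindowSystem hprim, fun W hW => ⟨hW.chi_ae_eq hlen,
    isCompact_totalWindow W, fun y => ?_, measurable_covering W,
    fun y => ⟨Nat.card {i // y ∈ W i}, by rw [covering_eq_card]; rfl⟩, support_covering W, ?_,
    fun y hy => ⟨Nat.card {i // y ∈ W i}, ?_, ?_, covering_eq_card W y⟩⟩⟩
  · by_cases hy : y ∈ totalWindow W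
    · rw [chi, Set.indicator_of_mem hy, mul_one]
    · rw [chi, Set.indicator_of_notMem hy, mul_zero]
      rwa [← support_covering, Function.notMem_support] at hy
  · rw [tsupport, support_covering, (isCompact_totalWindow W).isClosed.closure_eq]
  · rw [← support_covering, Function.mem_support, covering_eq_card, Nat.cast_ne_zero] at hy
    exact Nat.one_le_iff_ne_zero.2 hy
  · simpa using Finite.card_subtype_le fun i => y ∈ W i
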